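/- Let $m\ge 2$, $\delta>0$, $\mathcal B=[-\delta,\delta]$, and let $f\in C^{m+1}(\mathcal B)$ be a real function having $0$ as an $m$-fold root, i.e. $f^{(j)}(0)=0$ for $j=0,1,\dots,m-1$ and $f^{(m)}(0)\neq 0$. Let $k_0\in(-1,0)\cup(0,1)\cup(1,+\infty)$. Then there exists $\varepsilon>0$ (depending on $f$, $m$, $\delta$ and $k_0$) such that, for every real $e_0$ with $0<|e_0|<\varepsilon$, the secant method with initial values $e_0$ and $e_1=k_0e_0$, $$e_{n+1}=e_n-f(e_n)\,\frac{e_{n-1}-e_n}{f(e_{n-1})-f(e_n)}\qquad(n\ge 1),$$ is well defined, with $e_n\in\mathcal B$, $e_n\neq0$ and $f(e_n)\neq f(e_{n+1})$ for all $n\ge 0$, and the error sequence $\{e_n\}$ converges Q-linearly to $0$: $e_n\to 0$, and the limit $\lim_{n\to\infty}|e_{n+1}|/|e_n|$ exists and lies in $(0,1)$. Moreover, if $k_0\in(-1,0)$, then $k_1:=e_2/e_1\in(0,1)\cup(1,+\infty)$. -/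

import Mathlib

open Filter Topology

/-- One step of the secant method: the new iterate computed from the two latest iterates
`x` (older) and `y` (newer). It is meaningful when `f x ≠ f y`. -/
noncomputable def secantStep (f : ℝ → ℝ) (x y : ℝ) : ℝ :=
  y - f y * ((x - y) / (f x - f y))

/-- The sequence generated by the secant method from the initial values `x₀`, `x₁`. -/
noncomputable def secantSeq (f : ℝ → ℝ) (x₀ x₁ : ℝ) : ℕ → ℝ
  | 0 => x₀
  | 1 => x₁
  | n + 2 => secantStep f (secantSeq f x₀ x₁ n) (secantSeq f x₀ x₁ (n + 1))

/-- `a` is an `m`-fold root of `f`: the derivatives of order `0, …, m - 1` vanish at `a` and the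
one of order `m` does not. Used for functions that are `m` times continuously differentiable
near `a`. -/
def IsRootOfMultiplicity (f : ℝ → ℝ) (a : ℝ) (m : ℕ) : Prop :=
  (∀ j < m, iteratedDeriv j f a = 0) ∧ iteratedDeriv m f a ≠ 0

/-- Q-linear convergence of `x` to `L`: `x` converges to `L` and the quotients
`|x (n + 1) - L| / |x n - L|` converge to some `c` with `0 < c < 1`. -/
def ConvergesQLinearly (x : ℕ → ℝ) (L : ℝ) : Prop :=
  Tendsto x atTop (𝓝 L) ∧
    ∃ c : ℝ, 0 < c ∧ c < 1 ∧
      Tendsto (fun n => |x (n + 1) - L| / |x n - L|) atTop (𝓝 c)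

/-! Near the root `f x` is asymptotic to `a * x ^ m`, so the quotients `k n = e (n + 1) / e n` obey
`k (n + 1) = φ (k n) + o(1)` with `φ = secantRatio m`, as long as they stay in a compact set
avoiding `0` and `1` inside `(-1, ∞)` (`tendsto_secantStep`,
`eventually_secantStep_near_secantRatio`). For `-1 < k`, `k ≠ 0`, the value `φ k` is positive and
not `1`; for `0 < k` it is below `1`. Hence two steps bring the quotient near `φ (φ k₀)` in `(0,
1)`. As `φ` is antitone on `(0, ∞)` and at least `1/2` on `(0, 1]`, it sends `[α, β]` into `[1/2, φ
α]`; if `α < 1/2` and `φ α < β < 1`, small errors cannot leave `[α, β]`, and the iterates decay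
geometrically (`secant_trapped`). The quotients then converge: their liminf `l` and limsup `L`
satisfy `L ≤ φ l` and `φ L ≤ l`, so `L * φ L ≤ l * φ l`, and `k * φ k` is strictly increasing
(`exists_tendsto_of_antitoneOn_iterate`). -/

open Finset in
/-- The ratio map of the secant method for `x ^ m`: if `k` is the quotient of two consecutive
iterates, then `secantRatio m k` is the next quotient. -/
noncomputable def secantRatio (m : ℕ) (k : ℝ) : ℝ :=
  (∑ i ∈ range (m - 1), k ^ i) / ∑ i ∈ range m, k ^ i

/-! ### The ratio map and its perturbed iteration -/

section SecantRatio

open Finset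

variable {m : ℕ} {k : ℝ}

lemma geom_sum_pos_of_neg_one_lt {n : ℕ} (hn : n ≠ 0) (hk : -1 < k) :
    0 < ∑ i ∈ range n, k ^ i :=
  geom_sum_pos' (by linarith) hn

lemma secantRatio_pos (hm : 2 ≤ m) (hk : -1 < k) : 0 < secantRatio m k :=
  div_pos (geom_sum_pos_of_neg_one_lt (by omega) hk) (geom_sum_pos_of_neg_one_lt (by omega) hk)

lemma geom_sum_eq_pred_add (hm : 2 ≤ m) (k : ℝ) :
    ∑ i ∈ range m, k ^ i = ∑ i ∈ range (m - 1), k ^ i + k ^ (m - 1) := by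
  obtain ⟨p, rfl⟩ : ∃ p, m = p + 1 := ⟨m - 1, by omega⟩
  rw [sum_range_succ, Nat.add_sub_cancel]

lemma secantRatio_eq_one_sub (hm : 2 ≤ m) (hk : -1 < k) :
    secantRatio m k = 1 - k ^ (m - 1) / ∑ i ∈ range m, k ^ i := by
  have h := (geom_sum_pos_of_neg_one_lt (n := m) (by omega) hk).ne'
  rw [secantRatio, eq_sub_iff_add_eq, ← add_div, ← geom_sum_eq_pred_add hm, div_self h]

lemma mul_secantRatio (hm : 2 ≤ m) (hk : -1 < k) :
    k * secantRatio m k = 1 - 1 / ∑ i ∈ range m, k ^ i := by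
  have h := (geom_sum_pos_of_neg_one_lt (n := m) (by omega) hk).ne'
  have h' : ∑ i ∈ range m, k ^ i = k * ∑ i ∈ range (m - 1), k ^ i + 1 := by
    obtain ⟨p, rfl⟩ : ∃ p, m = p + 1 := ⟨m - 1, by omega⟩
    exact geom_sum_succ
  rw [secantRatio, eq_sub_iff_add_eq, ← mul_div_assoc, ← add_div, ← h', div_self h]

lemma secantRatio_ne_one (hm : 2 ≤ m) (hk : -1 < k) (hk0 : k ≠ 0) : secantRatio m k ≠ 1 := by
  rw [secantRatio_eq_one_sub hm hk]
  have := div_ne_zero (pow_ne_zero (m - 1) hk0)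
    (geom_sum_pos_of_neg_one_lt (n := m) (by omega) hk).ne'
  intro h
  exact this (by linarith)

lemma secantRatio_lt_one (hm : 2 ≤ m) (hk : 0 < k) : secantRatio m k < 1 := by
  rw [secantRatio_eq_one_sub hm (by linarith)]
  have := div_pos (pow_pos hk (m - 1))
    (geom_sum_pos_of_neg_one_lt (k := k) (n := m) (by omega) (by linarith))
  linarith

lemma continuousAt_secantRatio (hm : 2 ≤ m) (hk : -1 < k) : ContinuousAt (secantRatio m) k := by
  have h := (geom_sum_pos_of_neg_one_lt (n := m) (by omega) hk).ne'
  unfold secantRatio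
  exact ContinuousAt.div (by fun_prop) (by fun_prop) h

/-- In the form `1 - k ^ (m - 1) / ∑ k ^ i`, cross-multiplying reduces the claim to the termwise
bound `a ^ (m - 1) * b ^ i ≤ b ^ (m - 1) * a ^ i` for `i ≤ m - 1`. -/
lemma antitoneOn_secantRatio (hm : 2 ≤ m) : AntitoneOn (secantRatio m) (Set.Ioi 0) := by
  intro a ha b hb hab
  rw [Set.mem_Ioi] at ha hb
  rw [secantRatio_eq_one_sub hm (by linarith), secantRatio_eq_one_sub hm (by linarith)]
  refine sub_le_sub_left ?_ _
  rw [div_le_div_iff₀ (geom_sum_pos_of_neg_one_lt (by omega) (by linarith))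
    (geom_sum_pos_of_neg_one_lt (by omega) (by linarith)), mul_sum, mul_sum]
  refine sum_le_sum fun i hi => ?_
  rw [mem_range] at hi
  obtain ⟨j, hj⟩ : ∃ j, m - 1 = j + i := ⟨m - 1 - i, by omega⟩
  rw [hj, pow_add, pow_add]
  have := mul_le_mul_of_nonneg_right (pow_le_pow_left₀ ha.le hab j)
    (mul_pos (pow_pos ha i) (pow_pos hb i)).le
  linarith

lemma strictMonoOn_geom_sum (hm : 2 ≤ m) :
    StrictMonoOn (fun k : ℝ => ∑ i ∈ range m, k ^ i) (Set.Ioi 0) := by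
  intro a ha b _ hab
  refine sum_lt_sum (fun i _ => pow_le_pow_left₀ (le_of_lt ha) hab.le i)
    ⟨1, mem_range.2 (by omega), by simpa using hab⟩

lemma strictMonoOn_mul_secantRatio (hm : 2 ≤ m) :
    StrictMonoOn (fun k => k * secantRatio m k) (Set.Ioi 0) := by
  intro a ha b hb hab
  have h := strictMonoOn_geom_sum hm ha hb hab
  rw [Set.mem_Ioi] at ha hb
  simp only [mul_secantRatio hm (show -1 < a by linarith),
    mul_secantRatio hm (show -1 < b by linarith)]
  exact sub_lt_sub_left (one_div_lt_one_div_of_lt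
    (geom_sum_pos_of_neg_one_lt (by omega) (by linarith)) h) _

/-- By antitonicity the worst case is `k = 1`, where the value is `(m - 1) / m`. -/
lemma half_le_secantRatio (hm : 2 ≤ m) (hk : 0 < k) (hk1 : k ≤ 1) : 1 / 2 ≤ secantRatio m k := by
  refine le_trans ?_ (antitoneOn_secantRatio hm hk (Set.mem_Ioi.2 one_pos) hk1)
  obtain ⟨p, rfl⟩ : ∃ p, m = p + 2 := ⟨m - 2, by omega⟩
  have : (0 : ℝ) ≤ p := p.cast_nonneg
  simp only [secantRatio, one_pow, sum_const, card_range, nsmul_eq_mul, mul_one]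
  rw [show p + 2 - 1 = p + 1 by omega]
  push_cast
  rw [div_le_div_iff₀ (by norm_num) (by linarith)]
  linarith

lemma one_sub_pow_eq_zero_iff_of_neg_one_lt (hm : 2 ≤ m) (hk : -1 < k) :
    1 - k ^ m = 0 ↔ k = 1 := by
  rw [← mul_neg_geom_sum, mul_eq_zero,
    or_iff_left (geom_sum_pos_of_neg_one_lt (by omega) hk).ne', sub_eq_zero, eq_comm]

/-- The left side is the form in which the limit arises from `secantStep_div`, with `f y / f x`
replaced by `k ^ m`. -/
lemma one_sub_pow_mul_div_eq_secantRatio (hm : 2 ≤ m) (hk : -1 < k) (hk0 : k ≠ 0)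
    (hk1 : k ≠ 1) : 1 - k ^ m * (k⁻¹ - 1) / (1 - k ^ m) = secantRatio m k := by
  have h := (geom_sum_pos_of_neg_one_lt (n := m) (by omega) hk).ne'
  have h1 : 1 - k ≠ 0 := sub_ne_zero.2 hk1.symm
  rw [secantRatio_eq_one_sub hm hk, ← mul_neg_geom_sum]
  obtain ⟨p, rfl⟩ : ∃ p, m = p + 1 := ⟨m - 1, by omega⟩
  rw [Nat.add_sub_cancel, pow_succ]
  field_simp

/-- A perturbed iteration `x (n + 1) = φ (x n) + o(1)` in a compact interval converges if `φ` is
continuous and antitone and `x * φ x` is strictly increasing. -/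
lemma exists_tendsto_of_antitoneOn_iterate {φ : ℝ → ℝ} {α β : ℝ} {x : ℕ → ℝ} (hα : 0 < α)
    (hx : ∀ n, x n ∈ Set.Icc α β) (hφ : ∀ t, 0 < t → ContinuousAt φ t)
    (hanti : AntitoneOn φ (Set.Ioi 0)) (hmono : StrictMonoOn (fun t => t * φ t) (Set.Ioi 0))
    (herr : Tendsto (fun n => x (n + 1) - φ (x n)) atTop (𝓝 0)) :
    ∃ c ∈ Set.Icc α β, Tendsto x atTop (𝓝 c) := by
  have hle : IsBoundedUnder (· ≤ ·) atTop x := isBoundedUnder_of ⟨β, fun n => (hx n).2⟩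
  have hge : IsBoundedUnder (· ≥ ·) atTop x := isBoundedUnder_of ⟨α, fun n => (hx n).1⟩
  set l := liminf x atTop with hl
  set L := limsup x atTop with hL
  have hαl : α ≤ l :=
    le_liminf_of_le hle.isCoboundedUnder_ge (Eventually.of_forall fun n => (hx n).1)
  have hlL : l ≤ L := liminf_le_limsup hle hge
  have hl0 : 0 < l := hα.trans_le hαl
  have hL0 : 0 < L := hl0.trans_le hlL
  have hx0 (n : ℕ) : 0 < x n := hα.trans_le (hx n).1
  -- For `t < l`, eventually `t < x n`, hence `x (n + 1) ≤ φ t + o(1)`; continuity lets `t` approach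
  -- `l`. The bound `φ L ≤ l` is symmetric.
  have hLφ : L ≤ φ l := by
    refine le_of_forall_pos_le_add fun η hη => ?_
    obtain ⟨t, ⟨ht1, ht0⟩, htl⟩ : ∃ t, (φ t < φ l + η / 2 ∧ 0 < t) ∧ t < l :=
      ((((hφ l hl0).eventually_lt continuousAt_const (by linarith)).and
        (lt_mem_nhds hl0)).filter_mono nhdsWithin_le_nhds |>.and
        (self_mem_nhdsWithin (s := Set.Iio l))).exists
    rw [hL, ← limsup_nat_add x 1]
    refine limsup_le_of_le (IsBoundedUnder.isCoboundedUnder_le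
      (isBoundedUnder_of ⟨α, fun n => (hx (n + 1)).1⟩)) ?_
    filter_upwards [eventually_lt_of_lt_liminf htl hge,
      herr.eventually_lt_const (show (0 : ℝ) < η / 2 by linarith)] with n hn1 hn2
    have := hanti ht0 (hx0 n) hn1.le
    linarith
  have hφL : φ L ≤ l := by
    refine le_of_forall_pos_le_add fun η hη => ?_
    obtain ⟨t, ht1, htL⟩ : ∃ t, φ L - η / 2 < φ t ∧ L < t :=
      (((continuousAt_const.eventually_lt (hφ L hL0) (by linarith))).filter_mono
        nhdsWithin_le_nhds |>.and (self_mem_nhdsWithin (s := Set.Ioi L))).exists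
    rw [← sub_le_iff_le_add, hl, ← liminf_nat_add x 1]
    refine le_liminf_of_le (IsBoundedUnder.isCoboundedUnder_ge
      (isBoundedUnder_of ⟨β, fun n => (hx (n + 1)).2⟩)) ?_
    filter_upwards [eventually_lt_of_limsup_lt htL hle,
      herr.eventually_const_lt (show -(η / 2) < (0 : ℝ) by linarith)] with n hn1 hn2
    have := hanti (hx0 n) (hL0.trans htL) hn1.le
    linarith
  have hEq : L = l := by
    refine le_antisymm ?_ hlL
    rw [← hmono.le_iff_le hL0 hl0]
    calc L * φ L ≤ L * l := mul_le_mul_of_nonneg_left hφL hL0.le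
      _ = l * L := mul_comm _ _
      _ ≤ l * φ l := mul_le_mul_of_nonneg_left hLφ hl0.le
  have hlim : Tendsto x atTop (𝓝 l) := tendsto_of_liminf_eq_limsup hl.symm (hL.symm.trans hEq)
    hle hge
  exact ⟨l, isClosed_Icc.mem_of_tendsto hlim (Eventually.of_forall hx), hlim⟩

end SecantRatio

/-! ### Leading term at the root -/

lemma IsRootOfMultiplicity.tendsto_div_pow {f : ℝ → ℝ} {m : ℕ} {δ : ℝ} (hδ : 0 < δ)
    (hf : ContDiffOn ℝ m f (Set.Icc (-δ) δ)) (hroot : IsRootOfMultiplicity f 0 m) :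
    ∃ a ≠ 0, Tendsto (fun x => f x / x ^ m) (𝓝[≠] 0) (𝓝 a) := by
  -- On the open interval, derivatives within the set are the ordinary ones, so only the term of
  -- order `m` of the Taylor polynomial survives.
  have h0 : (0 : ℝ) ∈ Set.Ioo (-δ) δ := ⟨by linarith, hδ⟩
  have ht := Real.taylor_tendsto (convex_Ioo (-δ) δ) h0 (hf.mono Set.Ioo_subset_Icc_self)
  rw [isOpen_Ioo.nhdsWithin_eq h0] at ht
  replace ht := ht.mono_left (nhdsWithin_le_nhds (s := {0}ᶜ))
  refine ⟨(m.factorial : ℝ)⁻¹ * iteratedDeriv m f 0, mul_ne_zero (by positivity) hroot.2, ?_⟩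
  rw [← zero_add ((m.factorial : ℝ)⁻¹ * iteratedDeriv m f 0)]
  refine (ht.add_const ((m.factorial : ℝ)⁻¹ * iteratedDeriv m f 0)).congr' ?_
  filter_upwards [self_mem_nhdsWithin] with x hx
  have hx : x ≠ 0 := hx
  have htaylor : taylorWithinEval f m (Set.Ioo (-δ) δ) 0 x =
      (m.factorial : ℝ)⁻¹ * x ^ m * iteratedDeriv m f 0 := by
    rw [taylor_within_apply, Finset.sum_range_succ, Finset.sum_eq_zero, zero_add,
      iteratedDerivWithin_of_isOpen isOpen_Ioo h0, sub_zero, smul_eq_mul]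
    intro j hj
    rw [iteratedDerivWithin_of_isOpen isOpen_Ioo h0, hroot.1 j (Finset.mem_range.1 hj), smul_zero]
  rw [htaylor, sub_zero]
  have := pow_ne_zero m hx
  field_simp
  ring

/-! ### Asymptotics of one secant step -/

section Step

variable {f : ℝ → ℝ} {m : ℕ} {a : ℝ}

lemma secantStep_div {x y : ℝ} (hy : y ≠ 0) (hfx : f x ≠ 0) :
    secantStep f x y / y = 1 - f y / f x * ((y / x)⁻¹ - 1) / (1 - f y / f x) := by
  rw [secantStep, inv_div, show 1 - f y / f x = (f x - f y) / f x by field_simp]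
  -- If the denominator vanishes, division by zero makes both sides `1`.
  rcases eq_or_ne (f x - f y) 0 with h | h
  · simp [h, hy]
  · field_simp

/-- Asymptotics of one secant step near a root of order `m`, for iterates depending on a
parameter. -/
lemma tendsto_secantStep {ι : Type*} {l : Filter ι} {x y : ι → ℝ} {k : ℝ} (hm : 2 ≤ m)
    (ha : a ≠ 0) (hf : Tendsto (fun x => f x / x ^ m) (𝓝[≠] 0) (𝓝 a))
    (hk : -1 < k) (hk0 : k ≠ 0) (hk1 : k ≠ 1) (hx : Tendsto x l (𝓝[≠] 0))
    (hxy : Tendsto (fun i => y i / x i) l (𝓝 k)) :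
    Tendsto y l (𝓝[≠] 0) ∧ (∀ᶠ i in l, f (x i) ≠ f (y i)) ∧
      Tendsto (fun i => secantStep f (x i) (y i) / y i) l (𝓝 (secantRatio m k)) := by
  have hx0 : ∀ᶠ i in l, x i ≠ 0 := hx.eventually self_mem_nhdsWithin
  have hy : Tendsto y l (𝓝[≠] 0) := by
    refine tendsto_nhdsWithin_iff.2 ⟨?_, ?_⟩
    · have := hxy.mul (tendsto_nhds_of_tendsto_nhdsWithin hx)
      rw [mul_zero] at this
      refine this.congr' ?_
      filter_upwards [hx0] with i hi
      exact div_mul_cancel₀ _ hi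
    · filter_upwards [hxy.eventually_ne hk0] with i hi h
      exact hi (by rw [h, zero_div])
  have hy0 : ∀ᶠ i in l, y i ≠ 0 := hy.eventually self_mem_nhdsWithin
  have hfx0 : ∀ᶠ i in l, f (x i) ≠ 0 := by
    filter_upwards [(hf.comp hx).eventually_ne ha] with i hi h
    exact hi (by simp [h])
  -- Write `f y / f x` as `(y / x) ^ m` times the quotient of `f y / y ^ m` and `f x / x ^ m`, which
  -- tends to `a / a`.
  have hq : Tendsto (fun i => f (y i) / f (x i)) l (𝓝 (k ^ m)) := by
    have := (hxy.pow m).mul ((hf.comp hy).div (hf.comp hx) ha)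
    rw [div_self ha, mul_one] at this
    refine this.congr' ?_
    filter_upwards [hx0, hy0, hfx0] with i hxi hyi hfi
    have h1 := pow_ne_zero m hxi
    have h2 := pow_ne_zero m hyi
    simp only [Function.comp, Pi.div_apply, div_pow]
    field_simp
  have hden : 1 - k ^ m ≠ 0 := (one_sub_pow_eq_zero_iff_of_neg_one_lt hm hk).not.2 hk1
  refine ⟨hy, ?_, ?_⟩
  · filter_upwards [hfx0, hq.eventually_ne (sub_ne_zero.1 hden).symm] with i hi hqi h
    exact hqi (by rw [← h, div_self hi])
  · rw [← one_sub_pow_mul_div_eq_secantRatio hm hk hk0 hk1]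
    refine (((hq.mul ((hxy.inv₀ hk0).sub_const 1)).div (hq.const_sub 1) hden).const_sub 1).congr' ?_
    filter_upwards [hy0, hfx0] with i hi hfi
    exact (secantStep_div hi hfi).symm

/-- Uniformity in `k` comes from compactness: `tendsto_secantStep` along `𝓝[≠] 0 ×ˢ 𝓝 k` gives the
estimate for quotients near each `k`. -/
lemma eventually_secantStep_near_secantRatio (hm : 2 ≤ m) (ha : a ≠ 0)
    (hf : Tendsto (fun x => f x / x ^ m) (𝓝[≠] 0) (𝓝 a)) {K : Set ℝ} (hK : IsCompact K)
    (hK' : ∀ k ∈ K, -1 < k ∧ k ≠ 0 ∧ k ≠ 1) {η : ℝ} (hη : 0 < η) :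
    ∀ᶠ x in 𝓝[≠] (0 : ℝ), ∀ k ∈ K, f x ≠ f (k * x) ∧
      |secantStep f x (k * x) / (k * x) - secantRatio m k| < η := by
  have key : {p : ℝ × ℝ | f p.1 ≠ f (p.2 * p.1) ∧
      |secantStep f p.1 (p.2 * p.1) / (p.2 * p.1) - secantRatio m p.2| < η} ∈
      𝓝[≠] (0 : ℝ) ×ˢ 𝓝ˢ K := by
    refine hK.mem_prod_nhdsSet_of_forall fun k hk => ?_
    obtain ⟨hk, hk0, hk1⟩ := hK' k hk
    have hx : Tendsto Prod.fst (𝓝[≠] (0 : ℝ) ×ˢ 𝓝 k) (𝓝[≠] 0) := tendsto_fst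
    have hxy : Tendsto (fun p : ℝ × ℝ => p.2 * p.1 / p.1) (𝓝[≠] (0 : ℝ) ×ˢ 𝓝 k) (𝓝 k) := by
      refine tendsto_snd.congr' ?_
      filter_upwards [hx.eventually self_mem_nhdsWithin] with p hp
      exact (mul_div_cancel_right₀ _ hp).symm
    obtain ⟨-, h1, h2⟩ := tendsto_secantStep hm ha hf hk hk0 hk1 hx hxy
    have h3 := h2.sub ((continuousAt_secantRatio hm hk).tendsto.comp
      (tendsto_snd (f := 𝓝[≠] (0 : ℝ)) (g := 𝓝 k)))
    rw [sub_self] at h3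
    filter_upwards [h1, h3.abs.eventually_lt_const (by simpa using hη)] with p hp1 hp2
    exact ⟨hp1, hp2⟩
  obtain ⟨s, hs, t, ht, hst⟩ := mem_prod_iff.1 key
  filter_upwards [hs] with x hx k hk
  exact hst (Set.mk_mem_prod hx (subset_of_mem_nhdsSet ht hk))

end Step

/-! ### Trapping the quotients and the main theorem -/

lemma secantSeq_add_two (f : ℝ → ℝ) (x₀ x₁ : ℝ) (n : ℕ) :
    secantSeq f x₀ x₁ (n + 2) =
      secantStep f (secantSeq f x₀ x₁ n) (secantSeq f x₀ x₁ (n + 1)) := by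
  rw [secantSeq]

/-- A sequence generated by the secant method whose quotients are trapped in `[α, β] ⊆ (0, 1)`
once they enter this interval close enough to the root. -/
lemma secant_trapped {f : ℝ → ℝ} {m : ℕ} {a α β : ℝ} (hm : 2 ≤ m) (ha : a ≠ 0)
    (hf : Tendsto (fun x => f x / x ^ m) (𝓝[≠] 0) (𝓝 a)) (hα : 0 < α) (hα' : α < 1 / 2)
    (hβ : secantRatio m α < β) (hβ' : β < 1) :
    ∃ ρ > 0, ∀ e : ℕ → ℝ, (∀ n, e (n + 2) = secantStep f (e n) (e (n + 1))) → e 0 ≠ 0 →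
      |e 0| < ρ → e 1 / e 0 ∈ Set.Icc α β →
      (∀ n, e n ≠ 0 ∧ |e n| ≤ |e 0| ∧ f (e n) ≠ f (e (n + 1))) ∧ ConvergesQLinearly e 0 := by
  have hK : ∀ k ∈ Set.Icc α β, -1 < k ∧ k ≠ 0 ∧ k ≠ 1 := fun k hk =>
    ⟨by linarith [hk.1], (hα.trans_le hk.1).ne', (hk.2.trans_lt hβ').ne⟩
  -- This tolerance is the gap between `[1/2, φ α]`, which contains the image of `[α, β]`, and the
  -- ends of `[α, β]`.
  have hη : 0 < min (1 / 2 - α) (β - secantRatio m α) :=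
    lt_min (by linarith) (by linarith)
  have hnear := eventually_secantStep_near_secantRatio hm ha hf isCompact_Icc hK hη
  obtain ⟨ρ, hρ, hball⟩ := Metric.eventually_nhds_iff.1 (eventually_nhdsWithin_iff.1 hnear)
  refine ⟨ρ, hρ, fun e he he0 heρ hk0 => ?_⟩
  have hmain : ∀ n, e n ≠ 0 ∧ |e n| ≤ β ^ n * |e 0| ∧ e (n + 1) / e n ∈ Set.Icc α β := by
    intro n
    induction n with
    | zero => exact ⟨he0, by simp, hk0⟩
    | succ n ih =>
      obtain ⟨h0, hle, hk⟩ := ih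
      set k := e (n + 1) / e n with hkdef
      have hkpos : 0 < k := hα.trans_le hk.1
      have hek : e (n + 1) = k * e n := (div_mul_cancel₀ _ h0).symm
      have hβ0 : 0 ≤ β := hkpos.le.trans hk.2
      have hsmall : |e n| < ρ := by
        refine (hle.trans ?_).trans_lt heρ
        exact mul_le_of_le_one_left (abs_nonneg _) (pow_le_one₀ hβ0 hβ'.le)
      have h := (hball (by simpa using hsmall) h0 k hk).2
      rw [← hek, ← he n, abs_lt] at h
      refine ⟨hek ▸ mul_ne_zero hkpos.ne' h0, ?_, ?_⟩
      · rw [hek, abs_mul, abs_of_pos hkpos, pow_succ']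
        nlinarith [mul_le_mul hk.2 hle (abs_nonneg _) hβ0]
      · have h1 := min_le_left (1 / 2 - α) (β - secantRatio m α)
        have h2 := min_le_right (1 / 2 - α) (β - secantRatio m α)
        have h3 := half_le_secantRatio hm hkpos (hk.2.trans hβ'.le)
        have h4 := antitoneOn_secantRatio hm hα hkpos hk.1
        exact ⟨by linarith, by linarith⟩
  have hβ0 : 0 ≤ β := (hα.trans_le (hk0.1.trans hk0.2)).le
  have hle : ∀ n, |e n| ≤ |e 0| := fun n => (hmain n).2.1.trans
    (mul_le_of_le_one_left (abs_nonneg _) (pow_le_one₀ hβ0 hβ'.le))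
  have hek : ∀ n, e (n + 1) = e (n + 1) / e n * e n := fun n =>
    (div_mul_cancel₀ _ (hmain n).1).symm
  refine ⟨fun n => ⟨(hmain n).1, hle n, ?_⟩, ?_⟩
  · have h := (hball (by simpa using (hle n).trans_lt heρ) (hmain n).1 _ (hmain n).2.2).1
    rwa [← hek n] at h
  have hlim : Tendsto e atTop (𝓝 0) := by
    refine squeeze_zero_norm (fun n => (hmain n).2.1) ?_
    simpa using (tendsto_pow_atTop_nhds_zero_of_lt_one hβ0 hβ').mul_const |e 0|
  have hlim' : Tendsto e atTop (𝓝[≠] 0) :=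
    tendsto_nhdsWithin_iff.2 ⟨hlim, Eventually.of_forall fun n => (hmain n).1⟩
  obtain ⟨c, hc, hcl⟩ := exists_tendsto_of_antitoneOn_iterate
    (x := fun n => e (n + 1) / e n) hα (fun n => (hmain n).2.2)
    (fun t ht => continuousAt_secantRatio hm (by linarith)) (antitoneOn_secantRatio hm)
    (strictMonoOn_mul_secantRatio hm) <| by
      refine Metric.tendsto_nhds.2 fun η hη => ?_
      filter_upwards [hlim'.eventually
        (eventually_secantStep_near_secantRatio hm ha hf isCompact_Icc hK hη)] with n hn
      have h := (hn _ (hmain n).2.2).2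
      rwa [← hek n, ← he n, ← Real.norm_eq_abs, ← dist_zero_right] at h
  refine ⟨hlim, c, hα.trans_le hc.1, hc.2.trans_lt hβ', hcl.congr fun n => ?_⟩
  rw [sub_zero, sub_zero, ← abs_div, abs_of_pos (hα.trans_le (hmain n).2.2.1)]

theorem lemma4p7 (m : ℕ) (hm : 2 ≤ m) (δ : ℝ) (hδ : 0 < δ) (f : ℝ → ℝ)
    (hf : ContDiffOn ℝ (m + 1) f (Set.Icc (-δ) δ))
    (hroot : IsRootOfMultiplicity f 0 m)
    (k₀ : ℝ) (hk₀ : k₀ ∈ Set.Ioo (-1 : ℝ) 0 ∪ Set.Ioo 0 1 ∪ Set.Ioi 1) :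
    ∃ ε > 0, ∀ e₀ : ℝ, e₀ ≠ 0 → |e₀| < ε →
      -- the iteration is well defined: it stays in the domain, no denominator vanishes,
      -- and it never hits the root
      (∀ n, secantSeq f e₀ (k₀ * e₀) n ∈ Set.Icc (-δ) δ ∧
        secantSeq f e₀ (k₀ * e₀) n ≠ 0 ∧
        f (secantSeq f e₀ (k₀ * e₀) n) ≠ f (secantSeq f e₀ (k₀ * e₀) (n + 1))) ∧
      ConvergesQLinearly (secantSeq f e₀ (k₀ * e₀)) 0 ∧
      (k₀ ∈ Set.Ioo (-1 : ℝ) 0 →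
        secantSeq f e₀ (k₀ * e₀) 2 / secantSeq f e₀ (k₀ * e₀) 1 ∈
          Set.Ioo (0 : ℝ) 1 ∪ Set.Ioi 1) := by
  obtain ⟨a, ha, hfa⟩ := hroot.tendsto_div_pow hδ (hf.of_le (by exact_mod_cast m.le_succ))
  obtain ⟨hk, hk0, hk1⟩ : -1 < k₀ ∧ k₀ ≠ 0 ∧ k₀ ≠ 1 := by
    rcases hk₀ with (⟨h1, h2⟩ | ⟨h1, h2⟩) | h1
    · exact ⟨h1, h2.ne, by linarith⟩
    · exact ⟨by linarith, h1.ne', h2.ne⟩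
    · rw [Set.mem_Ioi] at h1
      exact ⟨by linarith, by linarith, h1.ne'⟩
  set k₁ := secantRatio m k₀ with hk₁
  have hk₁0 : 0 < k₁ := secantRatio_pos hm hk
  have hk₁1 : k₁ ≠ 1 := secantRatio_ne_one hm hk hk0
  set k₂ := secantRatio m k₁ with hk₂
  have hk₂0 : 0 < k₂ := secantRatio_pos hm (by linarith)
  have hk₂1 : k₂ < 1 := secantRatio_lt_one hm hk₁0
  -- The interval must be trapping and have `k₂` in its interior, so that `e 3 / e 2` lies in it for
  -- small `e₀`.
  obtain ⟨α, hα, hα'⟩ := exists_between (lt_min hk₂0 (one_half_pos (α := ℝ)))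
  obtain ⟨β, hβ, hβ'⟩ := exists_between (max_lt hk₂1 (secantRatio_lt_one hm hα))
  obtain ⟨hαk, hα2⟩ := lt_min_iff.1 hα'
  obtain ⟨hβk, hβα⟩ := max_lt_iff.1 hβ
  obtain ⟨ρ, hρ, htrap⟩ := secant_trapped hm ha hfa hα hα2 hβα hβ'
  -- The first iterates are treated as functions of the initial value `x → 0`.
  let s : ℝ → ℕ → ℝ := fun x => secantSeq f x (k₀ * x)
  have h0 : Tendsto (fun x => s x 0) (𝓝[≠] 0) (𝓝[≠] 0) := tendsto_id
  have hr0 : Tendsto (fun x => s x 1 / s x 0) (𝓝[≠] 0) (𝓝 k₀) := by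
    refine tendsto_const_nhds.congr' ?_
    filter_upwards [self_mem_nhdsWithin] with x hx
    exact (mul_div_cancel_right₀ k₀ hx).symm
  obtain ⟨h1, hne0, hr1⟩ := tendsto_secantStep hm ha hfa hk hk0 hk1 h0 hr0
  have hs (n : ℕ) (x : ℝ) : secantStep f (s x n) (s x (n + 1)) = s x (n + 2) :=
    (secantSeq_add_two f x (k₀ * x) n).symm
  replace hr1 : Tendsto (fun x => s x 2 / s x 1) (𝓝[≠] 0) (𝓝 k₁) := by
    refine hr1.congr fun x => ?_
    rw [← hs 0]
  obtain ⟨h2, hne1, hr2⟩ := tendsto_secantStep hm ha hfa (by linarith) hk₁0.ne' hk₁1 h1 hr1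
  have hr2' : Tendsto (fun x => s x 3 / s x 2) (𝓝[≠] 0) (𝓝 k₂) := by
    refine hr2.congr fun x => ?_
    rw [← hs 1]
  have hsmall {r : ℝ} (hr : 0 < r) {u : ℝ → ℝ} (hu : Tendsto u (𝓝[≠] 0) (𝓝[≠] 0)) :
      ∀ᶠ x in 𝓝[≠] (0 : ℝ), u x ≠ 0 ∧ |u x| < r := by
    refine (hu.eventually self_mem_nhdsWithin).and ?_
    refine (tendsto_nhds_of_tendsto_nhdsWithin hu).abs.eventually_lt_const ?_
    simpa using hr
  have hev : ∀ᶠ x in 𝓝[≠] (0 : ℝ), (s x 0 ≠ 0 ∧ |s x 0| < δ) ∧ (s x 1 ≠ 0 ∧ |s x 1| < δ) ∧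
      (s x 2 ≠ 0 ∧ |s x 2| < min ρ δ) ∧ f (s x 0) ≠ f (s x 1) ∧ f (s x 1) ≠ f (s x 2) ∧
      s x 3 / s x 2 ∈ Set.Icc α β ∧ 0 < s x 2 / s x 1 ∧ s x 2 / s x 1 ≠ 1 := by
    filter_upwards [hsmall hδ h0, hsmall hδ h1, hsmall (lt_min hρ hδ) h2, hne0, hne1,
      hr2'.eventually_mem (Icc_mem_nhds hαk hβk), hr1.eventually_const_lt hk₁0,
      hr1.eventually_ne hk₁1] with x a1 a2 a3 a4 a5 a6 a7 a8
    exact ⟨a1, a2, a3, a4, a5, a6, a7, a8⟩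
  obtain ⟨ε, hε, hball⟩ := Metric.eventually_nhds_iff.1 (eventually_nhdsWithin_iff.1 hev)
  refine ⟨ε, hε, fun x hx hxε => ?_⟩
  obtain ⟨⟨h00, h0δ⟩, ⟨h10, h1δ⟩, ⟨h20, h2ρ⟩, hf0, hf1, hI, hpos, hne⟩ :=
    hball (by simpa using hxε) hx
  obtain ⟨h2ρ, h2δ⟩ := lt_min_iff.1 h2ρ
  -- Trapping governs the tail from index `2`; the indices `0` and `1` are covered by `hball`.
  obtain ⟨hall, hlim, c, hc0, hc1, hc⟩ := htrap (fun n => s x (n + 2))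
    (fun n => (hs (n + 2) x).symm) h20 h2ρ hI
  refine ⟨fun n => ?_, ⟨(tendsto_add_atTop_iff_nat 2).1 hlim, c, hc0, hc1,
    (tendsto_add_atTop_iff_nat 2).1 hc⟩, fun _ => ?_⟩
  · match n with
    | 0 => exact ⟨abs_le.1 h0δ.le, h00, hf0⟩
    | 1 => exact ⟨abs_le.1 h1δ.le, h10, hf1⟩
    | n + 2 => exact ⟨abs_le.1 ((hall n).2.1.trans h2δ.le), (hall n).1, (hall n).2.2⟩
  · rcases hne.lt_or_gt with h | h
    · exact Or.inl ⟨hpos, h⟩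
    · exact Or.inr h
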